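/- Theorem 1.3. Let $n\ge 3$ be an integer and $0<m<\frac{n-2}{n}$. For $\rho_1>0$ and $\beta\in\mathbb{R}$ put $$\beta_1=\frac{\rho_1}{n-2-nm},\qquad \beta_0=\begin{cases}\rho_1\sqrt{\dfrac{2(1-m)}{n-2-nm}} & \text{if } 0<m\le\frac{n-2}{n+2},\\[2ex] \rho_1\max\left(2\sqrt{\dfrac{2(1-m)}{n-2-nm}},\ \dfrac{(n+2)m-(n-2)}{n-2-nm}\right) & \text{if } \frac{n-2}{n+2}<m<\frac{n-2}{n},\end{cases}$$ $$C_*=\frac{2m(n-2-nm)}{(1-m)\rho_1},\qquad A(\beta)=n-2-(n+2)m+\frac{2\beta(n-2-nm)}{\rho_1},$$ and, for $\beta\ge\beta_0$, let $$\gamma_1=\frac{1}{2(1-m)}\left(A(\beta)-\sqrt{A(\beta)^2-8(n-2-nm)(1-m)}\right),$$ which is the smaller root of $\gamma^2-\frac{A(\beta)}{1-m}\gamma+\frac{2(n-2-nm)}{1-m}=0$ (the roots are real for $\beta\ge\beta_0$). There is a constant $b=b(n,m)$, depending only on $n$ and $m$, such that for every $\rho_1>0$ the number $\beta_2:=b\rho_1$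 satisfies $\beta_2\ge\max(\beta_0,\beta_1)$ and the following holds. Let $\beta>\beta_2$, $\alpha=\frac{2\beta+\rho_1}{1-m}$ and $\lambda>0$. Then $\gamma_1>0$, and for every radially symmetric positive classical ($C^2$) solution $v_\lambda$ of $$\Delta (v^m)+\alpha v+\beta\, x\cdot\nabla v=0\quad\text{in }\mathbb{R}^n$$ with $v_\lambda(0)=\lambda$ there is a constant $B>0$ such that $$v_\lambda(x)=\left(\frac{C_*}{|x|^2}\right)^{\frac{1}{1-m}}\left(1-B|x|^{-\gamma_1}+o(|x|^{-\gamma_1})\right)\qquad\text{as }|x|\to\infty.$$ -/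

import Mathlib

open scoped Asymptotics

/-- A function on `ℝⁿ` is radially symmetric if its value at `x` depends only on `|x|`. -/
def IsRadial {n : ℕ} (v : EuclideanSpace ℝ (Fin n) → ℝ) : Prop :=
  ∀ x y, ‖x‖ = ‖y‖ → v x = v y

/-- `v` is a classical (twice continuously differentiable) positive solution on all of `ℝⁿ` of
`Δ(v ^ m) + α v + β x · ∇v = 0`. -/
structure IsEntireSolution {n : ℕ} (m α β : ℝ) (v : EuclideanSpace ℝ (Fin n) → ℝ) : Prop where
  contDiff : ContDiff ℝ 2 v
  pos : ∀ x, 0 < v x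
  equation : ∀ x,
    Laplacian.laplacian (fun y => v y ^ m) x + α * v x
      + β * inner ℝ x (gradient v x) = 0

/-- The constant `α = (2β + ρ₁) / (1 - m)`. -/
noncomputable def alphaCoeff (m ρ₁ β : ℝ) : ℝ := (2 * β + ρ₁) / (1 - m)

/-- The constant `β₀`. -/
noncomputable def betaZero (n : ℕ) (m ρ₁ : ℝ) : ℝ :=
  if m ≤ ((n : ℝ) - 2) / (n + 2) then
    ρ₁ * √(2 * (1 - m) / (n - 2 - n * m))
  else
    ρ₁ * max (2 * √(2 * (1 - m) / (n - 2 - n * m)))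
      (((n + 2) * m - (n - 2)) / (n - 2 - n * m))

/-- The constant `β₁ = ρ₁ / (n - 2 - nm)`. -/
noncomputable def betaOne (n : ℕ) (m ρ₁ : ℝ) : ℝ := ρ₁ / (n - 2 - n * m)

/-- The constant `C_* = 2m(n - 2 - nm) / ((1 - m)ρ₁)`. -/
noncomputable def cStar (n : ℕ) (m ρ₁ : ℝ) : ℝ :=
  2 * m * (n - 2 - n * m) / ((1 - m) * ρ₁)

/-- `A(β) = n - 2 - (n + 2)m + 2β(n - 2 - nm) / ρ₁`. -/
noncomputable def capA (n : ℕ) (m ρ₁ β : ℝ) : ℝ :=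
  n - 2 - (n + 2) * m + 2 * β * (n - 2 - n * m) / ρ₁

/-- The smaller root `γ₁` of the quadratic equation
`γ² - (A(β) / (1 - m)) γ + 2(n - 2 - nm) / (1 - m) = 0`
(its roots are real for `β ≥ β₀`, see `gammaOne_isLeast`). -/
noncomputable def gammaOne (n : ℕ) (m ρ₁ β : ℝ) : ℝ :=
  1 / (2 * (1 - m)) *
    (capA n m ρ₁ β - √(capA n m ρ₁ β ^ 2 - 8 * (n - 2 - n * m) * (1 - m)))

/-- For `β ≥ β₀` the discriminant is nonnegative. -/
theorem capA_disc_nonneg {n : ℕ} {m ρ₁ β : ℝ} (hn : 3 ≤ n) (hm : 0 < m)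
    (hmn : m < ((n : ℝ) - 2) / n) (hρ : 0 < ρ₁) (hβ : betaZero n m ρ₁ ≤ β) :
    0 ≤ capA n m ρ₁ β ^ 2 - 8 * (n - 2 - n * m) * (1 - m) := by
  have hn' : (3 : ℝ) ≤ n := by exact_mod_cast hn
  rw [lt_div_iff₀ (by linarith)] at hmn
  have hm1 : m < 1 := by nlinarith
  obtain ⟨k, hk⟩ : ∃ k : ℝ, k = n - 2 - n * m := ⟨_, rfl⟩
  have hk0 : 0 < k := by rw [hk]; linarith
  obtain ⟨b, hb⟩ : ∃ b : ℝ, b = β / ρ₁ := ⟨_, rfl⟩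
  have hβb : β = ρ₁ * b := by rw [hb]; field_simp
  have hA : capA n m ρ₁ β = n - 2 - (n + 2) * m + 2 * b * k := by
    rw [capA, hβb, ← hk]; field_simp
  have hs : √(2 * (1 - m) / k) ^ 2 * k = 2 * (1 - m) := by
    rw [Real.sq_sqrt (div_nonneg (by linarith) hk0.le)]; field_simp
  have hs0 := Real.sqrt_nonneg (2 * (1 - m) / k)
  obtain ⟨s, hsd⟩ : ∃ s : ℝ, s = √(2 * (1 - m) / k) := ⟨_, rfl⟩
  rw [hA, ← hk]
  rw [betaZero, ← hk, hβb] at hβ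
  rw [← hsd] at hs hs0 hβ
  split_ifs at hβ with h
  · rw [le_div_iff₀ (by linarith)] at h
    have h1 : s ≤ b := le_of_mul_le_mul_left hβ hρ
    have h2 : 2 * s * k ≤ n - 2 - (n + 2) * m + 2 * b * k := by nlinarith
    have h3 : (2 * s * k) ^ 2 ≤ (n - 2 - (n + 2) * m + 2 * b * k) ^ 2 :=
      pow_le_pow_left₀ (by positivity) h2 2
    have h4 : (2 * s * k) ^ 2 = 8 * k * (1 - m) := by linear_combination 4 * k * hs
    linarith
  · have h1 := le_of_mul_le_mul_left hβ hρ
    have h2 := (le_max_left _ _).trans h1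
    have h3 := (le_max_right _ _).trans h1
    rw [div_le_iff₀ hk0] at h3
    have h5 : 2 * s * k ≤ n - 2 - (n + 2) * m + 2 * b * k := by nlinarith
    have h6 : (2 * s * k) ^ 2 ≤ (n - 2 - (n + 2) * m + 2 * b * k) ^ 2 :=
      pow_le_pow_left₀ (by positivity) h5 2
    have h4 : (2 * s * k) ^ 2 = 8 * k * (1 - m) := by linear_combination 4 * k * hs
    linarith

/-- For `β ≥ β₀`, `γ₁` is the smallest real root of the characteristic quadratic. -/
theorem gammaOne_isLeast {n : ℕ} {m ρ₁ β : ℝ} (hn : 3 ≤ n) (hm : 0 < m)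
    (hmn : m < ((n : ℝ) - 2) / n) (hρ : 0 < ρ₁) (hβ : betaZero n m ρ₁ ≤ β) :
    IsLeast {γ : ℝ | γ ^ 2
        - (((n : ℝ) - 2 - (n + 2) * m) / (1 - m)
            + 2 * β * (n - 2 - n * m) / ((1 - m) * ρ₁)) * γ
        + 2 * (n - 2 - n * m) / (1 - m) = 0} (gammaOne n m ρ₁ β) := by
  have hD := capA_disc_nonneg hn hm hmn hρ hβ
  have hn' : (3 : ℝ) ≤ n := by exact_mod_cast hn
  rw [lt_div_iff₀ (by linarith)] at hmn
  have hm1 : 0 < 1 - m := by nlinarith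
  have hc : ((n : ℝ) - 2 - (n + 2) * m) / (1 - m) + 2 * β * (n - 2 - n * m) / ((1 - m) * ρ₁)
      = capA n m ρ₁ β / (1 - m) := by
    rw [capA]; field_simp
  rw [hc]
  have hS := Real.sq_sqrt hD
  have hS0 := Real.sqrt_nonneg (capA n m ρ₁ β ^ 2 - 8 * (n - 2 - n * m) * (1 - m))
  rw [gammaOne]
  generalize √(capA n m ρ₁ β ^ 2 - 8 * (n - 2 - n * m) * (1 - m)) = S at hS hS0 ⊢
  generalize capA n m ρ₁ β = A at hS ⊢
  constructor
  · rw [Set.mem_ofPred_eq]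
    field_simp
    linear_combination hS
  · intro γ hγ
    rw [Set.mem_ofPred_eq] at hγ
    field_simp at hγ
    rw [div_mul_eq_mul_div, one_mul, div_le_iff₀ (by linarith)]
    have h2 : (2 * (1 - m) * γ - A) ^ 2 = S ^ 2 := by
      linear_combination (4 * (1 - m)) * hγ - hS
    have h3 := abs_le_of_sq_le_sq h2.le hS0
    linarith [(abs_le.mp h3).1]

/-!
Let `v` be a radial solution, `V` its restriction to a line through the origin and
`N = n - 2 - nm`. In the scale `r = exp s` the ratio `w = r ² V ^ (1 - m) / C_*` of `v ^ (1 - m)`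
to the singular solution and the logarithmic slope `z = r w' / w = 2 + (1 - m) r V' / V` satisfy
an autonomous quadratic system, `dw/ds = z w` and
`dz/ds = -θ z² - (a + D w) z + Q (1 - w)` with `θ = m / (1 - m)`, `D = 2Nβ / ((1 - m)ρ₁)`,
`Q = 2N / (1 - m)` and `a + D = A(β) / (1 - m)`. The singular solution is the equilibrium `(1, 0)`,
and `(w, z) → (0, 2)` at the origin.

The key estimate is `0 < z < 2 (1 - w)` for all `r > 0`, valid as soon as `β > β₁`. The function
`F = r ^ (n - 1) (V ^ m)' + β₁ r ^ n V` is a positive multiple of `z - 2 (1 - w)`; it vanishes at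
the origin, and the equation in divergence form shows that it decreases as long as `z > 0`
(`IsRadialProfile.logSlope_lt`). At a first zero of `z` one would have `w < 1`, hence
`dz/ds = Q (1 - w) > 0`, which is absurd (`IsRadialProfile.logSlope_pos`). The barrier
`z = 2 (1 - w)` is the explicit Barenblatt solution for `β = β₁`.

Put `f = 1 - w` and `y = z / f`. Then `f, y` take values in `(0, 1)` and `(0, 2)`, and
`df/ds = -y (1 - f) f`, `dy/ds = P(y) + O(f)`, where `P(y) = y² - A(β) y / (1 - m) + Q` has the
roots `γ₁ < 2 < γ₂` because `P(2) < 0` for `β > β₁` (`gammaOne_spec`). As `y < 2 < γ₂`, the root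
`γ₁` attracts: first `y` is bounded below, so `f` decays exponentially, then `y → γ₁` exponentially,
and so `log f + γ₁ s` converges (`exists_tendsto_mul_exp_of_hasDerivAt`). Thus `f ~ B₀ r ^ (-γ₁)`
with `B₀ > 0`, and expanding `v = (C_* / r²) ^ (1 / (1 - m)) (1 - f) ^ (1 / (1 - m))` gives the
theorem with `B = B₀ / (1 - m)` and `b ρ₁ = max β₀ β₁`.
-/

open Filter Topology MeasureTheory

/-! ### Differential inequalities and elementary asymptotics -/

/-- Grönwall's inequality for a linear bound, with a coefficient of either sign. -/
theorem le_mul_exp_of_hasDerivAt_le {g g' : ℝ → ℝ} {c : ℝ}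
    (hg : ∀ s, 0 ≤ s → HasDerivAt g (g' s) s) (hg' : ∀ s, 0 ≤ s → g' s ≤ -c * g s)
    {s : ℝ} (hs : 0 ≤ s) : g s ≤ g 0 * Real.exp (-c * s) := by
  have hd : ∀ s, 0 ≤ s → HasDerivAt (fun s => g s * Real.exp (c * s))
      ((g' s + c * g s) * Real.exp (c * s)) s := fun s hs => by
    have h1 : HasDerivAt (fun s => Real.exp (c * s)) (Real.exp (c * s) * (c * 1)) s :=
      ((hasDerivAt_id s).const_mul c).exp
    exact ((hg s hs).mul h1).congr_deriv (by ring)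
  have hanti : AntitoneOn (fun s => g s * Real.exp (c * s)) (Set.Ici 0) := by
    refine antitoneOn_of_deriv_nonpos (convex_Ici 0)
      (fun s hs => (hd s hs).continuousAt.continuousWithinAt) ?_ ?_
    · intro s hs
      rw [interior_Ici] at hs
      exact (hd s (le_of_lt hs)).differentiableAt.differentiableWithinAt
    · intro s hs
      rw [interior_Ici] at hs
      rw [(hd s (le_of_lt hs)).deriv]
      exact mul_nonpos_of_nonpos_of_nonneg (by linarith [hg' s (le_of_lt hs)]) (Real.exp_pos _).le
  have h := hanti (Set.self_mem_Ici) hs hs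
  simp only [mul_zero, Real.exp_zero, mul_one] at h
  rw [neg_mul, Real.exp_neg, ← div_eq_mul_inv, le_div_iff₀ (Real.exp_pos _)]
  exact h

/-- A function that is positive to the left of one of its zeros has nonpositive derivative there. -/
theorem HasDerivAt.nonpos_of_pos_left {z : ℝ → ℝ} {z' a r : ℝ} (h : HasDerivAt z z' r)
    (har : a < r) (hr : z r = 0) (hpos : ∀ t, a < t → t < r → 0 < z t) : z' ≤ 0 := by
  have h1 : Tendsto (slope z r) (𝓝[<] r) (𝓝 z') :=
    (hasDerivAt_iff_tendsto_slope.1 h).mono_left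
      (nhdsWithin_mono _ fun t ht => ne_of_lt ht)
  refine le_of_tendsto h1 ?_
  filter_upwards [Ioo_mem_nhdsLT har] with t ht
  rw [slope_def_field, hr, sub_zero]
  exact (div_neg_of_pos_of_neg (hpos t ht.1 ht.2) (by linarith [ht.2])).le

/-- If `f ~ B exp (-γ s)`, then `(1 - f) ^ q = 1 - q B exp (-γ s) + o(exp (-γ s))`. -/
theorem isLittleO_one_sub_rpow {f : ℝ → ℝ} {γ B q : ℝ} (hγ : 0 < γ)
    (hf : Tendsto (fun s => f s * Real.exp (γ * s)) atTop (𝓝 B)) :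
    (fun s => (1 - f s) ^ q - 1 + q * B * Real.exp (-γ * s)) =o[atTop]
      fun s => Real.exp (-γ * s) := by
  have hexp : Tendsto (fun s : ℝ => Real.exp (-γ * s)) atTop (𝓝 0) :=
    Real.tendsto_exp_atBot.comp (tendsto_id.const_mul_atTop_of_neg (by linarith))
  have hfe : ∀ s, f s = f s * Real.exp (γ * s) * Real.exp (-γ * s) := fun s => by
    rw [mul_assoc, ← Real.exp_add]; simp
  have hfO : f =O[atTop] fun s => Real.exp (-γ * s) := by
    have h := (hf.isBigO_one ℝ).mul
      (Asymptotics.isBigO_refl (fun s : ℝ => Real.exp (-γ * s)) atTop)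
    simp only [one_mul] at h
    exact h.congr_left fun s => (hfe s).symm
  have hf0 : Tendsto f atTop (𝓝 0) := hfO.trans_tendsto hexp
  have hd : HasDerivAt (fun x : ℝ => (1 - x) ^ q) (-q) 0 := by
    have h1 : HasDerivAt (fun x : ℝ => 1 - x) (-1) 0 := (hasDerivAt_id (0 : ℝ)).const_sub 1
    simpa using h1.rpow_const (p := q) (by simp)
  have h1 : (fun s => (1 - f s) ^ q - 1 + q * f s) =o[atTop] fun s => Real.exp (-γ * s) := by
    have h2 := (hasDerivAt_iff_isLittleO.1 hd).comp_tendsto hf0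
    refine ((h2.congr_right fun s => ?_).trans_isBigO hfO).congr_left fun s => ?_
    · simp
    · simp [Function.comp]
      ring
  have h2 : (fun s => -q * (f s * Real.exp (γ * s) - B) * Real.exp (-γ * s)) =o[atTop]
      fun s => Real.exp (-γ * s) := by
    have h3 : (fun s => -q * (f s * Real.exp (γ * s) - B)) =o[atTop] fun _ => (1 : ℝ) := by
      rw [Asymptotics.isLittleO_one_iff]
      simpa using (hf.sub_const B).const_mul (-q)
    simpa using h3.mul_isBigO (Asymptotics.isBigO_refl (fun s : ℝ => Real.exp (-γ * s)) atTop)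
  refine (h1.add h2).congr_left fun s => ?_
  linear_combination q * hfe s

/-! ### The quadratic system near the equilibrium -/

/-- Asymptotics of the system for `f = 1 - w` and `y = z / f` in the variable `s`. The numbers `γ`
and `E - γ` are the roots of `X² - E X + Q`; since `y < 2 < E - γ`, the slope `y` is driven to `γ`
and `f` decays exactly like `exp (-γ s)`. -/
theorem exists_tendsto_mul_exp_of_hasDerivAt {f y : ℝ → ℝ} {E D k Q γ : ℝ}
    (hf0 : ∀ s, 0 < f s) (hf1 : ∀ s, f s < 1) (hy0 : ∀ s, 0 < y s) (hy2 : ∀ s, y s < 2)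
    (hf : ∀ s, HasDerivAt f (-(y s * (1 - f s) * f s)) s)
    (hy : ∀ s, HasDerivAt y (y s ^ 2 - E * y s + Q + f s * y s * (D - k * y s)) s)
    (hQ : 0 < Q) (hD : 0 ≤ D) (hk : 0 ≤ k) (hγE : 2 < E - γ) (hγ : γ * (E - γ) = Q) :
    ∃ B, 0 < B ∧ Tendsto (fun s => f s * Real.exp (γ * s)) atTop (𝓝 B) := by
  -- `y` is bounded below, because `y' ≥ Q - M y` for a constant `M`
  obtain ⟨c, hc, hcy⟩ : ∃ c, 0 < c ∧ ∀ s, 0 ≤ s → c ≤ y s := by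
    have hM : 0 < |E| + 2 * k + 1 := by positivity
    refine ⟨min (y 0) (Q / (|E| + 2 * k + 1)), lt_min (hy0 0) (by positivity), fun s hs => ?_⟩
    set c := min (y 0) (Q / (|E| + 2 * k + 1)) with hc
    have hcQ : (|E| + 2 * k + 1) * c ≤ Q := by
      have := min_le_right (y 0) (Q / (|E| + 2 * k + 1))
      rw [← hc, le_div_iff₀ hM] at this
      linarith
    have h := le_mul_exp_of_hasDerivAt_le (g := fun s => c - y s) (c := |E| + 2 * k + 1)
      (fun s _ => (hy s).const_sub c) (fun s _ => by
        have h0 := hy0 s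
        have h1 : E * y s ≤ |E| * y s := mul_le_mul_of_nonneg_right (le_abs_self E) h0.le
        have h2 : f s * y s * (k * y s) ≤ 1 * y s * (k * 2) := by
          have := hf0 s
          gcongr
          · exact (hf1 s).le
          · exact (hy2 s).le
        have h3 : 0 ≤ f s * y s * D := by have := hf0 s; positivity
        nlinarith [sq_nonneg (y s)]) hs
    have h0 : c - y 0 ≤ 0 := by linarith [min_le_left (y 0) (Q / (|E| + 2 * k + 1))]
    have := mul_nonpos_of_nonpos_of_nonneg h0 (Real.exp_pos (-(|E| + 2 * k + 1) * s)).le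
    linarith
  -- hence `f` decays exponentially; the rate is taken at most `κ = E - γ - 2`
  have hfanti : ∀ s, 0 ≤ s → f s ≤ f 0 := fun s hs => by
    simpa using le_mul_exp_of_hasDerivAt_le (c := 0) (fun s _ => hf s) (fun s _ => by
      have := mul_pos (mul_pos (hy0 s) (sub_pos.2 (hf1 s))) (hf0 s)
      linarith) hs
  set κ := E - γ - 2 with hκ
  have hκ0 : 0 < κ := by linarith
  obtain ⟨c', hc'0, hc'κ, hfdecay⟩ : ∃ c', 0 < c' ∧ c' ≤ κ ∧
      ∀ s, 0 ≤ s → f s ≤ Real.exp (-c' * s) := by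
    have hp : 0 < c * (1 - f 0) := mul_pos hc (sub_pos.2 (hf1 0))
    refine ⟨min (c * (1 - f 0)) κ, lt_min hp hκ0, min_le_right _ _, fun s hs => ?_⟩
    have h := le_mul_exp_of_hasDerivAt_le (c := c * (1 - f 0)) (fun s _ => hf s) (fun s hs => by
      have h1 : c * (1 - f 0) ≤ y s * (1 - f s) := by
        have := hf1 0
        have := hy0 s
        have := hfanti s hs
        have := hcy s hs
        gcongr
      nlinarith [hf0 s]) hs
    calc f s ≤ _ := h
      _ ≤ 1 * Real.exp (-(c * (1 - f 0)) * s) := by gcongr; exact (hf1 0).le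
      _ ≤ Real.exp (-min (c * (1 - f 0)) κ * s) := by
        rw [one_mul]
        gcongr
        exact min_le_left _ _
  -- The error term of `y' = (y - γ) (y - (E - γ)) + O(f)` is exponentially small and
  -- `y - (E - γ) ≤ -κ`. As `c' ≤ κ`, subtracting `(K / κ) exp (-c' s)` absorbs that error.
  obtain ⟨C, hC0, hδ⟩ : ∃ C, 0 ≤ C ∧ ∀ s, 0 ≤ s → (y s - γ) ^ 2 ≤ C * Real.exp (-c' * s) := by
    obtain ⟨K, hK⟩ : ∃ K, K = 2 * (2 + |γ|) * (2 * (D + k * 2)) := ⟨_, rfl⟩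
    have hK0 : 0 ≤ K := by rw [hK]; positivity
    have hder : ∀ s, HasDerivAt (fun s => (y s - γ) ^ 2 - K / κ * Real.exp (-c' * s))
        (2 * (y s - γ) * (y s ^ 2 - E * y s + Q + f s * y s * (D - k * y s))
          + c' * (K / κ * Real.exp (-c' * s))) s := fun s => by
      have h1 : HasDerivAt (fun s => Real.exp (-c' * s)) (Real.exp (-c' * s) * (-c' * 1)) s :=
        ((hasDerivAt_id s).const_mul (-c')).exp
      exact ((((hy s).sub_const γ).pow 2).sub (h1.const_mul (K / κ))).congr_deriv
        (by push_cast; ring)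
    have hle : ∀ s, 0 ≤ s → 2 * (y s - γ) * (y s ^ 2 - E * y s + Q + f s * y s * (D - k * y s))
          + c' * (K / κ * Real.exp (-c' * s)) ≤
        -(2 * κ) * ((y s - γ) ^ 2 - K / κ * Real.exp (-c' * s)) := fun s hs => by
      have e1 : y s ^ 2 - E * y s + Q = (y s - γ) * (y s - (E - γ)) := by
        linear_combination -hγ
      have e2 : |2 * (y s - γ) * (f s * y s * (D - k * y s))| ≤ K * Real.exp (-c' * s) := by
        have a1 : |y s - γ| ≤ 2 + |γ| :=
          (abs_sub _ _).trans (by rw [abs_of_pos (hy0 s)]; linarith [hy2 s])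
        have a2 : |D - k * y s| ≤ D + k * 2 := by
          refine (abs_sub _ _).trans ?_
          rw [abs_of_nonneg hD, abs_of_nonneg (mul_nonneg hk (hy0 s).le)]
          have := hy2 s
          gcongr
        rw [abs_mul, abs_mul, abs_mul, abs_mul, abs_two, abs_of_pos (hf0 s), abs_of_pos (hy0 s)]
        calc 2 * |y s - γ| * (f s * y s * |D - k * y s|)
            ≤ 2 * (2 + |γ|) * (Real.exp (-c' * s) * 2 * (D + k * 2)) := by
              have := hf0 s
              have := hy0 s
              gcongr
              · exact hfdecay s hs
              · exact (hy2 s).le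
          _ = K * Real.exp (-c' * s) := by rw [hK]; ring
      have e3 : c' * (K / κ * Real.exp (-c' * s)) ≤ K * Real.exp (-c' * s) := by
        calc c' * (K / κ * Real.exp (-c' * s)) ≤ κ * (K / κ * Real.exp (-c' * s)) := by gcongr
          _ = K * Real.exp (-c' * s) := by field_simp
      have e4 : κ * (K / κ * Real.exp (-c' * s)) = K * Real.exp (-c' * s) := by field_simp
      have e5 : (y s - γ) ^ 2 * (y s - (E - γ)) ≤ (y s - γ) ^ 2 * (-κ) :=
        mul_le_mul_of_nonneg_left (by linarith [hy2 s]) (sq_nonneg _)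
      rw [e1]
      linarith [le_of_abs_le e2]
    refine ⟨K / κ + (y 0 - γ) ^ 2, by positivity, fun s hs => ?_⟩
    have h := le_mul_exp_of_hasDerivAt_le (fun s _ => hder s) hle hs
    have h1 : ((y 0 - γ) ^ 2 - K / κ * Real.exp (-c' * 0)) * Real.exp (-(2 * κ) * s) ≤
        (y 0 - γ) ^ 2 * Real.exp (-c' * s) := by
      have : 0 ≤ K / κ * Real.exp (-c' * 0) := by positivity
      gcongr
      · linarith
      · linarith
    linarith
  -- so `log f + γ s` has an integrable derivative, and converges
  have hL : ∀ s, HasDerivAt (fun s => Real.log (f s) + γ * s) (-(y s - γ) + y s * f s) s :=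
    fun s => by
      have h1 := (hf s).log (hf0 s).ne'
      have h2 : HasDerivAt (fun s => γ * s) (γ * 1) s := (hasDerivAt_id s).const_mul γ
      refine (h1.add h2).congr_deriv ?_
      have := (hf0 s).ne'
      field_simp
      ring
  have hfc : Continuous f := continuous_iff_continuousAt.2 fun s => (hf s).continuousAt
  have hyc : Continuous y := continuous_iff_continuousAt.2 fun s => (hy s).continuousAt
  have hint : IntegrableOn (fun s => -(y s - γ) + y s * f s) (Set.Ioi 0) := by
    have hi := (exp_neg_integrableOn_Ioi 0 (half_pos hc'0)).const_mul (√C + 2)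
    refine Integrable.mono' hi (by fun_prop) ?_
    refine (ae_restrict_iff' measurableSet_Ioi).2 (Eventually.of_forall fun s hs => ?_)
    have hs : 0 ≤ s := le_of_lt hs
    have h1 : |y s - γ| ≤ √C * Real.exp (-(c' / 2) * s) := by
      refine abs_le_of_sq_le_sq ?_ (by positivity)
      rw [mul_pow, Real.sq_sqrt hC0, ← Real.exp_nat_mul,
        show ((2 : ℕ) : ℝ) * (-(c' / 2) * s) = -c' * s by push_cast; ring]
      exact hδ s hs
    have h2 : y s * f s ≤ 2 * Real.exp (-(c' / 2) * s) := by
      have := hf0 s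
      have := (hfdecay s hs).trans (Real.exp_le_exp.2
        (show -c' * s ≤ -(c' / 2) * s by nlinarith))
      gcongr
      exact (hy2 s).le
    rw [Real.norm_eq_abs]
    refine (abs_add_le _ _).trans ?_
    rw [abs_neg, abs_of_pos (mul_pos (hy0 s) (hf0 s))]
    linarith
  have hlim := tendsto_limUnder_of_hasDerivAt_of_integrableOn_Ioi (fun s _ => hL s) hint
  refine ⟨_, Real.exp_pos _, (Real.continuous_exp.continuousAt.tendsto.comp hlim).congr fun s => ?_⟩
  simp only [Function.comp]
  rw [Real.exp_add, Real.exp_log (hf0 s)]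

/-! ### The Laplacian of a radial function -/

/-- The radial form `U'' + (n - 1) U' / r` of the Laplacian, on a coordinate axis. -/
theorem laplacian_eq_of_isRadial {n : ℕ} {u : EuclideanSpace ℝ (Fin n) → ℝ}
    (hu : ContDiff ℝ 2 u) (hr : IsRadial u) (i : Fin n) {r : ℝ} (hr0 : 0 < r) :
    Laplacian.laplacian u (EuclideanSpace.single i r) =
      deriv (deriv fun t => u (EuclideanSpace.single i t)) r
        + (n - 1) * (deriv (fun t => u (EuclideanSpace.single i t)) r / r) := by
  set U : ℝ → ℝ := fun t => u (EuclideanSpace.single i t) with hU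
  set x : EuclideanSpace ℝ (Fin n) := EuclideanSpace.single i r with hx
  have hsingle : ∀ t : ℝ, EuclideanSpace.single i t = t • EuclideanSpace.single i (1 : ℝ) := by
    intro t; ext j; simp
  have hUc : ContDiff ℝ 2 U := by
    have h : U = fun t : ℝ => u (t • EuclideanSpace.single i (1 : ℝ)) := by
      ext t; rw [hU]; simp only; rw [hsingle]
    rw [h]; fun_prop
  have hUd : ∀ t, HasDerivAt U (deriv U t) t := fun t =>
    (hUc.differentiable (by norm_num) t).hasDerivAt
  have hU'c : ContDiff ℝ 1 (deriv U) := (contDiff_succ_iff_deriv (n := 1)).1 hUc |>.2.2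
  have hU'd : ∀ t, HasDerivAt (deriv U) (deriv (deriv U) t) t := fun t =>
    (hU'c.differentiable (by norm_num) t).hasDerivAt
  have hline : ∀ (e : EuclideanSpace ℝ (Fin n)),
      iteratedFDeriv ℝ 2 u x ![e, e] = deriv (deriv fun t : ℝ => u (x + t • e)) 0 := by
    intro e
    have hl : ∀ t : ℝ, HasDerivAt (fun t : ℝ => x + t • e) e t := fun t => by
      simpa using ((hasDerivAt_id t).smul_const e).const_add x
    have h1 : (deriv fun t : ℝ => u (x + t • e)) = fun t => fderiv ℝ u (x + t • e) e := by
      ext t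
      exact ((hu.differentiable (by norm_num) _).hasFDerivAt.comp_hasDerivAt t (hl t)).deriv
    have hu' : ContDiff ℝ 1 (fderiv ℝ u) := hu.fderiv_right (by norm_num)
    have h2 : HasDerivAt (fun t : ℝ => fderiv ℝ u (x + t • e) e)
        (fderiv ℝ (fderiv ℝ u) x e e) 0 := by
      have h3 := (hu'.differentiable (by norm_num) (x + (0 : ℝ) • e)).hasFDerivAt.comp_hasDerivAt
        (0 : ℝ) (hl 0)
      have h4 := h3.clm_apply (hasDerivAt_const (0 : ℝ) e)
      simpa using h4
    rw [h1, h2.deriv, iteratedFDeriv_two_apply]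
    simp
  rw [InnerProductSpace.laplacian_eq_iteratedFDeriv_orthonormalBasis u
    (EuclideanSpace.basisFun (Fin n) ℝ)]
  simp only [hline, EuclideanSpace.basisFun_apply]
  have hi : deriv (deriv fun t : ℝ => u (x + t • EuclideanSpace.single i (1 : ℝ))) 0
      = deriv (deriv U) r := by
    have h : (fun t : ℝ => u (x + t • EuclideanSpace.single i (1 : ℝ))) = fun t => U (r + t) := by
      ext t
      simp only [hU, hx]
      rw [hsingle r, hsingle (r + t), add_smul]
    rw [h]
    rw [show (deriv fun t => U (r + t)) = fun t => deriv U (r + t) from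
      funext fun t => deriv_comp_const_add U r t, deriv_comp_const_add, add_zero]
  have hj : ∀ j, j ≠ i → deriv (deriv fun t : ℝ => u (x + t • EuclideanSpace.single j (1 : ℝ))) 0
      = deriv U r / r := by
    intro j hj
    have h : (fun t : ℝ => u (x + t • EuclideanSpace.single j (1 : ℝ)))
        = fun t => U (√(r ^ 2 + t ^ 2)) := by
      ext t
      rw [hU]
      refine hr _ _ ?_
      have h1 : ‖x + t • EuclideanSpace.single j (1 : ℝ)‖ ^ 2 = r ^ 2 + t ^ 2 := by
        rw [@norm_add_sq_real, real_inner_smul_right, hx, norm_smul]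
        simp [EuclideanSpace.inner_single_left, hj.symm]
      rw [PiLp.norm_single, Real.norm_eq_abs, abs_of_nonneg (Real.sqrt_nonneg _), ← h1,
        Real.sqrt_sq (norm_nonneg _)]
    have hpos : ∀ t : ℝ, 0 < r ^ 2 + t ^ 2 := fun t => by positivity
    have hq : ∀ t : ℝ, HasDerivAt (fun t => √(r ^ 2 + t ^ 2)) (t / √(r ^ 2 + t ^ 2)) t :=
      fun t => by
        have h1 : HasDerivAt (fun t : ℝ => r ^ 2 + t ^ 2) (2 * t) t := by
          simpa using (hasDerivAt_pow 2 t).const_add (r ^ 2)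
        refine (h1.sqrt (hpos t).ne').congr_deriv ?_
        have := Real.sqrt_pos.2 (hpos t)
        field_simp
    have hd1 : (deriv fun t => U (√(r ^ 2 + t ^ 2)))
        = fun t => deriv U (√(r ^ 2 + t ^ 2)) / √(r ^ 2 + t ^ 2) * t := by
      ext t
      rw [(show HasDerivAt (fun t => U (√(r ^ 2 + t ^ 2))) _ t from (hUd _).comp t (hq t)).deriv]
      ring
    -- The derivative at `0` of `ψ(t) * t` is `ψ(0)` for differentiable `ψ`.
    rw [h, hd1]
    have hd2 : DifferentiableAt ℝ
        (fun t => deriv U (√(r ^ 2 + t ^ 2)) / √(r ^ 2 + t ^ 2)) 0 := by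
      have := hpos 0
      exact (((hU'd _).comp 0 (hq 0)).differentiableAt).div (hq 0).differentiableAt
        (Real.sqrt_pos.2 this).ne'
    have h3 := hd2.hasDerivAt.mul (hasDerivAt_id (0 : ℝ))
    have h4 : (fun t => deriv U (√(r ^ 2 + t ^ 2)) / √(r ^ 2 + t ^ 2) * t)
      = (fun t => deriv U (√(r ^ 2 + t ^ 2)) / √(r ^ 2 + t ^ 2)) * id := rfl
    rw [h4, h3.deriv]
    simp [Real.sqrt_sq hr0.le]
  rw [← Finset.add_sum_erase _ _ (Finset.mem_univ i), hi,
    Finset.sum_congr rfl fun j hj' => hj j (Finset.ne_of_mem_erase hj')]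
  have hn : 1 ≤ n := by have := i.2; omega
  simp [Finset.card_erase_of_mem, Nat.cast_sub hn]

/-! ### The characteristic exponent -/

/-- For `β > β₁` the number `2` separates the two positive roots of the characteristic quadratic:
`γ₁` is the smaller one and `A(β) / (1 - m) - γ₁` the larger one. -/
theorem gammaOne_spec {n : ℕ} {m ρ β : ℝ} (hm1 : m < 1) (hN : 0 < (n : ℝ) - 2 - n * m)
    (hρ : 0 < ρ) (hβ : betaOne n m ρ < β) :
    0 < gammaOne n m ρ β ∧ 2 < capA n m ρ β / (1 - m) - gammaOne n m ρ β ∧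
      gammaOne n m ρ β * (capA n m ρ β / (1 - m) - gammaOne n m ρ β)
        = 2 * (n - 2 - n * m) / (1 - m) := by
  have hε : 0 < 1 - m := by linarith
  rw [betaOne, div_lt_iff₀ hN] at hβ
  have hA : (n : ℝ) - 2 - n * m + 2 * (1 - m) < capA n m ρ β := by
    have h1 : 1 < β * (n - 2 - n * m) / ρ := (one_lt_div hρ).2 hβ
    have h2 : 2 * β * ((n : ℝ) - 2 - n * m) / ρ = 2 * (β * (n - 2 - n * m) / ρ) := by ring
    rw [capA, h2]
    linarith
  rw [gammaOne]
  generalize capA n m ρ β = A at hA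
  generalize (n : ℝ) - 2 - n * m = N at *
  have hlt : (A - 4 * (1 - m)) ^ 2 < A ^ 2 - 8 * N * (1 - m) := by
    nlinarith [mul_pos hε (sub_pos.2 hA)]
  have hS := Real.sq_sqrt ((sq_nonneg _).trans hlt.le)
  have hS1 := abs_lt.1 (abs_lt_of_sq_lt_sq (hS ▸ hlt) (Real.sqrt_nonneg _))
  generalize √(A ^ 2 - 8 * N * (1 - m)) = S at hS hS1
  have h2 : 2 < A / (1 - m) - 1 / (2 * (1 - m)) * (A - S) := by
    rw [show A / (1 - m) - 1 / (2 * (1 - m)) * (A - S) = (A + S) / (2 * (1 - m)) by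
      field_simp; ring, lt_div_iff₀ (by linarith)]
    linarith
  have h3 : 1 / (2 * (1 - m)) * (A - S) * (A / (1 - m) - 1 / (2 * (1 - m)) * (A - S))
      = 2 * N / (1 - m) := by
    field_simp
    linear_combination -hS
  have h4 : 0 < 2 * N / (1 - m) := by positivity
  rw [← h3] at h4
  exact ⟨pos_of_mul_pos_left h4 (by linarith), h2, h3⟩

/-! ### The profile of a radial solution -/

/-- `V` is a positive `C²` function on the line solving, for `r > 0`, the radial form of
`Δ(v ^ m) + α v + β x · ∇v = 0` in dimension `n`. The even extension of the profile of a classical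
solution to negative `r` is of this kind. -/
structure IsRadialProfile (n : ℕ) (m α β : ℝ) (V : ℝ → ℝ) : Prop where
  contDiff : ContDiff ℝ 2 V
  pos : ∀ t, 0 < V t
  equation : ∀ r, 0 < r → deriv (deriv fun t => V t ^ m) r
    + (n - 1) * (deriv (fun t => V t ^ m) r / r) + α * V r + β * (r * deriv V r) = 0

/-- A radial entire solution, restricted to a coordinate axis, solves the radial equation. -/
theorem IsEntireSolution.isRadialProfile {n : ℕ} {m α β : ℝ} {v : EuclideanSpace ℝ (Fin n) → ℝ}
    (hv : IsEntireSolution m α β v) (hr : IsRadial v) (i : Fin n) :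
    IsRadialProfile n m α β fun t => v (EuclideanSpace.single i t) := by
  have hu : ContDiff ℝ 2 fun y => v y ^ m := hv.contDiff.rpow_const_of_ne fun x => (hv.pos x).ne'
  have hur : IsRadial fun y => v y ^ m := fun x y hxy => by simp only; rw [hr x y hxy]
  have hsingle : ∀ t : ℝ, EuclideanSpace.single i t = t • EuclideanSpace.single i (1 : ℝ) := by
    intro t; ext j; simp
  have hfun : (fun t : ℝ => EuclideanSpace.single i t)
      = fun t : ℝ => t • EuclideanSpace.single i (1 : ℝ) := funext hsingle
  refine ⟨?_, fun t => hv.pos _, fun r hr0 => ?_⟩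
  · have hc : ContDiff ℝ 2 fun t : ℝ => EuclideanSpace.single i t := by rw [hfun]; fun_prop
    exact hv.contDiff.comp hc
  have hgrad : r * deriv (fun t => v (EuclideanSpace.single i t)) r =
      inner ℝ (EuclideanSpace.single i r) (gradient v (EuclideanSpace.single i r)) := by
    rw [inner_gradient_right, conj_trivial]
    have hl : HasDerivAt (fun t : ℝ => EuclideanSpace.single i t)
        (EuclideanSpace.single i (1 : ℝ)) r := by
      rw [hfun]
      simpa using (hasDerivAt_id r).smul_const (EuclideanSpace.single i (1 : ℝ))
    have h := (hv.contDiff.differentiable (by norm_num) _).hasFDerivAt.comp_hasDerivAt r hl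
    rw [show deriv (fun t => v (EuclideanSpace.single i t)) r = _ from h.deriv]
    conv_rhs => rw [hsingle r, map_smul, ← hsingle r, smul_eq_mul]
  rw [hgrad, ← laplacian_eq_of_isRadial hu hur i hr0]
  exact hv.equation _

/-! ### The logarithmic slope and its barrier -/

/-- The logarithmic slope `z = 2 + (1 - m) r V' / V`, which is `r w' / w` for `w` the
`singularRatio`. -/
noncomputable def logSlope (m : ℝ) (V : ℝ → ℝ) (r : ℝ) : ℝ := 2 + (1 - m) * (r * deriv V r / V r)

/-- The ratio `w = r² V ^ (1 - m) / C`: the `(1 - m)`-th power of the quotient of `V` by the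
singular profile `(C / r²) ^ (1 / (1 - m))`. -/
noncomputable def singularRatio (m C : ℝ) (V : ℝ → ℝ) (r : ℝ) : ℝ := r ^ 2 * V r ^ (1 - m) / C

theorem hasDerivAt_rpow_comp {V : ℝ → ℝ} (hV : ContDiff ℝ 2 V) (hpos : ∀ t, 0 < V t) (m t : ℝ) :
    HasDerivAt (fun t => V t ^ m) (m * (V t ^ m / V t * deriv V t)) t := by
  refine ((hV.differentiable (by norm_num) t).hasDerivAt.rpow_const (p := m)
    (Or.inl (hpos t).ne')).congr_deriv ?_
  rw [Real.rpow_sub_one (hpos t).ne']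
  ring

theorem hasDerivAt_deriv_rpow {V : ℝ → ℝ} (hV : ContDiff ℝ 2 V) (hpos : ∀ t, 0 < V t) (m t : ℝ) :
    HasDerivAt (deriv fun t => V t ^ m)
      (m * (V t ^ m / V t * ((m - 1) * deriv V t ^ 2 / V t + deriv (deriv V) t))) t := by
  rw [show (deriv fun t => V t ^ m) = fun t => m * (V t ^ m / V t * deriv V t) from
    funext fun t => (hasDerivAt_rpow_comp hV hpos m t).deriv]
  have hV' : ContDiff ℝ 1 (deriv V) := (contDiff_succ_iff_deriv (n := 1)).1 hV |>.2.2
  have h1 := (hV.differentiable (by norm_num) t).hasDerivAt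
  have h2 := (hV'.differentiable (by norm_num) t).hasDerivAt
  have h0 := (hpos t).ne'
  refine ((((hasDerivAt_rpow_comp hV hpos m t).div h1 h0).mul h2).const_mul m).congr_deriv ?_
  simp only [Pi.div_apply]
  field_simp

namespace IsRadialProfile
variable {n : ℕ} {m ρ β : ℝ} {V : ℝ → ℝ}

theorem hasDerivAt_singularRatio {α C : ℝ} (h : IsRadialProfile n m α β V) {r : ℝ} (hr : 0 < r) :
    HasDerivAt (singularRatio m C V) (logSlope m V r * singularRatio m C V r / r) r := by
  have h0 := (h.pos r).ne'
  refine (((hasDerivAt_pow 2 r).mul (hasDerivAt_rpow_comp h.contDiff h.pos (1 - m) r)).div_const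
    C).congr_deriv ?_
  rw [logSlope, singularRatio]
  push_cast
  field_simp

/-- The radial equation solved for `V''`. -/
theorem second_deriv_eq {α : ℝ} (h : IsRadialProfile n m α β V) (hm : m ≠ 0) {r : ℝ}
    (hr : 0 < r) :
    deriv (deriv V) r = (1 - m) * deriv V r ^ 2 / V r - (n - 1) * deriv V r / r
      - V r ^ (1 - m) / m * (α * V r + β * (r * deriv V r)) := by
  have h0 := (h.pos r).ne'
  have hX := (Real.rpow_pos_of_pos (h.pos r) m).ne'
  have he := h.equation r hr
  rw [(hasDerivAt_rpow_comp h.contDiff h.pos m r).deriv,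
    (hasDerivAt_deriv_rpow h.contDiff h.pos m r).deriv] at he
  rw [Real.rpow_sub (h.pos r), Real.rpow_one]
  field_simp at he ⊢
  linear_combination he

theorem hasDerivAt_logSlope (h : IsRadialProfile n m (alphaCoeff m ρ β) β V) (hm : 0 < m)
    (hm1 : m < 1) (hN : 0 < (n : ℝ) - 2 - n * m) (hρ : 0 < ρ) {r : ℝ} (hr : 0 < r) :
    HasDerivAt (logSlope m V)
      ((-(m / (1 - m)) * logSlope m V r ^ 2
        - (capA n m ρ β / (1 - m) - 2 * (n - 2 - n * m) * β / ((1 - m) * ρ)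
            + 2 * (n - 2 - n * m) * β / ((1 - m) * ρ) * singularRatio m (cStar n m ρ) V r)
          * logSlope m V r
        + 2 * (n - 2 - n * m) / (1 - m) * (1 - singularRatio m (cStar n m ρ) V r)) / r) r := by
  have h0 := (h.pos r).ne'
  have hV' : ContDiff ℝ 1 (deriv V) := (contDiff_succ_iff_deriv (n := 1)).1 h.contDiff |>.2.2
  have h1 := (h.contDiff.differentiable (by norm_num) r).hasDerivAt
  have h2 := (hV'.differentiable (by norm_num) r).hasDerivAt
  refine (((((hasDerivAt_id r).mul h2).div h1 h0).const_mul (1 - m)).const_add 2).congr_deriv ?_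
  rw [h.second_deriv_eq hm.ne' hr, logSlope, singularRatio, cStar, alphaCoeff, capA]
  have hm1' : 1 - m ≠ 0 := by linarith
  simp only [Pi.mul_apply, id]
  generalize V r ^ (1 - m) = W
  generalize (n : ℝ) = N at *
  obtain ⟨K, hK⟩ : ∃ K, K = N - 2 - N * m := ⟨_, rfl⟩
  rw [← hK] at hN ⊢
  field_simp
  subst hK
  ring

theorem continuous_logSlope {α : ℝ} (h : IsRadialProfile n m α β V) :
    Continuous (logSlope m V) := by
  have hV' : ContDiff ℝ 1 (deriv V) := (contDiff_succ_iff_deriv (n := 1)).1 h.contDiff |>.2.2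
  have h1 := h.contDiff.continuous
  have h2 := hV'.continuous
  exact continuous_const.add (continuous_const.mul
    ((continuous_id.mul h2).div₀ h1 fun t => (h.pos t).ne'))

/-- The barrier `z < 2 (1 - w)` holds up to the first zero of `z`: its sign is that of
`F = r ^ (n - 1) (V ^ m)' + β₁ r ^ n V`, which vanishes at `0` and decreases while `z > 0`. -/
theorem logSlope_lt (hn : 3 ≤ n) (h : IsRadialProfile n m (alphaCoeff m ρ β) β V) (hm : 0 < m)
    (hm1 : m < 1) (hN : 0 < (n : ℝ) - 2 - n * m) (hβ : betaOne n m ρ < β)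
    {R : ℝ} (hR : 0 < R) (hpos : ∀ r, 0 < r → r < R → 0 < logSlope m V r) :
    logSlope m V R < 2 * (1 - singularRatio m (cStar n m ρ) V R) := by
  obtain ⟨k, rfl⟩ : ∃ k, n = k + 2 := ⟨n - 2, by omega⟩
  have hk : k ≠ 0 := by omega
  have hV' : ContDiff ℝ 1 (deriv V) := (contDiff_succ_iff_deriv (n := 1)).1 h.contDiff |>.2.2
  set F : ℝ → ℝ := fun r => r ^ (k + 1) * deriv (fun t => V t ^ m) r
    + betaOne (k + 2 : ℕ) m ρ * (r ^ (k + 2) * V r) with hF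
  have hm1' : 0 < 1 - m := by linarith
  have hFd : ∀ r, 0 < r → HasDerivAt F
      (-((β - betaOne (k + 2 : ℕ) m ρ) * r ^ (k + 1) * V r / (1 - m) * logSlope m V r)) r := by
    intro r hr
    have h0 := (h.pos r).ne'
    have he := h.equation r hr
    have hd := hasDerivAt_deriv_rpow h.contDiff h.pos m r
    rw [← hd.deriv] at hd
    have h1 := (h.contDiff.differentiable (by norm_num) r).hasDerivAt
    have hb : alphaCoeff m ρ β = ((k + 2 : ℕ) : ℝ) * betaOne (k + 2 : ℕ) m ρ
        + 2 * (β - betaOne (k + 2 : ℕ) m ρ) / (1 - m) := by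
      rw [alphaCoeff, betaOne]
      generalize ((k + 2 : ℕ) : ℝ) = N at *
      obtain ⟨K, hK⟩ : ∃ K, K = N - 2 - N * m := ⟨_, rfl⟩
      rw [← hK] at hN ⊢
      field_simp
      subst hK
      ring
    have hU : deriv (deriv fun t => V t ^ m) r = -((k + 1) * (deriv (fun t => V t ^ m) r / r))
        - alphaCoeff m ρ β * V r - β * (r * deriv V r) := by
      push_cast at he
      linear_combination he
    refine (((hasDerivAt_pow (k + 1) r).mul hd).add
      (((hasDerivAt_pow (k + 2) r).mul h1).const_mul _)).congr_deriv ?_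
    rw [logSlope, hU, hb, show k + 1 - 1 = k from rfl, show k + 2 - 1 = k + 1 from rfl]
    push_cast
    field_simp
    ring
  have hUc : Continuous (deriv fun t => V t ^ m) := continuous_iff_continuousAt.2 fun t =>
    (hasDerivAt_deriv_rpow h.contDiff h.pos m t).continuousAt
  have hFc : Continuous F := ((continuous_pow (k + 1)).mul hUc).add
    (continuous_const.mul ((continuous_pow (k + 2)).mul h.contDiff.continuous))
  have hanti : StrictAntiOn F (Set.Icc 0 R) := by
    refine strictAntiOn_of_deriv_neg (convex_Icc 0 R) hFc.continuousOn fun r hr => ?_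
    rw [interior_Icc] at hr
    rw [(hFd r hr.1).deriv, neg_lt_zero]
    have := hpos r hr.1 hr.2
    have := h.pos r
    have := sub_pos.2 hβ
    have := hr.1
    positivity
  have hFR := hanti (Set.left_mem_Icc.2 hR.le) (Set.right_mem_Icc.2 hR.le) hR
  have h0 := h.pos R
  have hX := Real.rpow_pos_of_pos (h.pos R) m
  have hkey : logSlope m V R - 2 * (1 - singularRatio m (cStar (k + 2 : ℕ) m ρ) V R)
      = (1 - m) / (m * R ^ k * V R ^ m) * F R := by
    simp only [hF]
    rw [(hasDerivAt_rpow_comp h.contDiff h.pos m R).deriv, logSlope, singularRatio, cStar, betaOne,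
      Real.rpow_sub (h.pos R), Real.rpow_one]
    generalize ((k + 2 : ℕ) : ℝ) = N at *
    obtain ⟨K, hK⟩ : ∃ K, K = N - 2 - N * m := ⟨_, rfl⟩
    rw [← hK] at hN ⊢
    field_simp
    ring
  have hF0 : F 0 = 0 := by simp [hF]
  rw [hF0] at hFR
  have : (1 - m) / (m * R ^ k * V R ^ m) * F R < 0 :=
    mul_neg_of_pos_of_neg (by positivity) hFR
  linarith

theorem singularRatio_pos (h : IsRadialProfile n m (alphaCoeff m ρ β) β V) (hm : 0 < m)
    (hm1 : m < 1) (hN : 0 < (n : ℝ) - 2 - n * m) (hρ : 0 < ρ) {r : ℝ} (hr : 0 < r) :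
    0 < singularRatio m (cStar n m ρ) V r := by
  have h1 := Real.rpow_pos_of_pos (h.pos r) (1 - m)
  have h2 : 0 < 1 - m := by linarith
  rw [singularRatio, cStar]
  positivity

/-- The slope `z` never vanishes: at a first zero the barrier gives `w < 1`, and the equation for `z`
then makes its derivative positive. -/
theorem logSlope_pos (hn : 3 ≤ n) (h : IsRadialProfile n m (alphaCoeff m ρ β) β V) (hm : 0 < m)
    (hm1 : m < 1) (hN : 0 < (n : ℝ) - 2 - n * m) (hρ : 0 < ρ) (hβ : betaOne n m ρ < β)
    {r : ℝ} (hr : 0 < r) : 0 < logSlope m V r := by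
  by_contra! hneg
  have hc := h.continuous_logSlope
  set S : Set ℝ := Set.Icc 0 r ∩ logSlope m V ⁻¹' Set.Iic 0 with hS
  have hScl : IsClosed S := isClosed_Icc.inter (isClosed_Iic.preimage hc)
  have hSne : S.Nonempty := ⟨r, ⟨hr.le, le_rfl⟩, hneg⟩
  have hSbdd : BddBelow S := ⟨0, fun t ht => ht.1.1⟩
  obtain ⟨hR, hRz⟩ := hScl.csInf_mem hSne hSbdd
  set R := sInf S with hRdef
  have hz0 : logSlope m V 0 = 2 := by simp [logSlope]
  have hR0 : 0 < R := hR.1.lt_of_ne fun h0 => by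
    rw [← h0, Set.mem_preimage, hz0, Set.mem_Iic] at hRz
    norm_num at hRz
  have hpos : ∀ t, 0 < t → t < R → 0 < logSlope m V t := fun t ht htR => by
    by_contra! hle
    exact absurd (csInf_le hSbdd ⟨⟨ht.le, htR.le.trans hR.2⟩, hle⟩) (not_le.2 htR)
  have hzR : logSlope m V R = 0 := by
    refine le_antisymm hRz (ge_of_tendsto (hc.continuousAt.tendsto.mono_left
      (nhdsWithin_le_nhds (s := Set.Iio R))) ?_)
    filter_upwards [Ioo_mem_nhdsLT hR0] with t ht
    exact (hpos t ht.1 ht.2).le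
  have hlt := h.logSlope_lt hn hm hm1 hN hβ hR0 hpos
  have hd := (h.hasDerivAt_logSlope hm hm1 hN hρ hR0).nonpos_of_pos_left hR0 hzR hpos
  rw [hzR] at hlt hd
  have : 0 < (2 * ((n : ℝ) - 2 - n * m) / (1 - m) *
      (1 - singularRatio m (cStar n m ρ) V R)) / R := by
    have h1 : 0 < 1 - m := by linarith
    have h2 : 0 < 1 - singularRatio m (cStar n m ρ) V R := by linarith
    positivity
  simp only [ne_eq, OfNat.ofNat_ne_zero, not_false_eq_true, zero_pow, mul_zero, sub_zero,
    zero_add] at hd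
  linarith

/-- The profile approaches the singular one exactly at the rate `γ₁`, with positive coefficient. -/
theorem exists_tendsto_one_sub_singularRatio_mul_exp (hn : 3 ≤ n)
    (h : IsRadialProfile n m (alphaCoeff m ρ β) β V) (hm : 0 < m)
    (hm1 : m < 1) (hN : 0 < (n : ℝ) - 2 - n * m) (hρ : 0 < ρ) (hβ : betaOne n m ρ < β) :
    ∃ B, 0 < B ∧ Tendsto (fun s => (1 - singularRatio m (cStar n m ρ) V (Real.exp s))
      * Real.exp (gammaOne n m ρ β * s)) atTop (𝓝 B) := by
  obtain ⟨-, hγ2, hγQ⟩ := gammaOne_spec hm1 hN hρ hβ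
  have hm1' : 0 < 1 - m := by linarith
  have hβ0 : 0 < β := lt_trans (div_pos hρ hN) hβ
  set C := cStar n m ρ with hC
  have hw0 : ∀ s, 0 < singularRatio m C V (Real.exp s) := fun s =>
    h.singularRatio_pos hm hm1 hN hρ (Real.exp_pos s)
  have hz0 : ∀ s, 0 < logSlope m V (Real.exp s) := fun s =>
    h.logSlope_pos hn hm hm1 hN hρ hβ (Real.exp_pos s)
  have hzw : ∀ s, logSlope m V (Real.exp s) < 2 * (1 - singularRatio m C V (Real.exp s)) :=
    fun s => h.logSlope_lt hn hm hm1 hN hβ (Real.exp_pos s) fun r hr _ =>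
      h.logSlope_pos hn hm hm1 hN hρ hβ hr
  have hf0 : ∀ s, 0 < 1 - singularRatio m C V (Real.exp s) := fun s => by
    linarith [hz0 s, hzw s]
  have hwd : ∀ s, HasDerivAt (fun s => singularRatio m C V (Real.exp s))
      (logSlope m V (Real.exp s) * singularRatio m C V (Real.exp s)) s := fun s => by
    refine ((h.hasDerivAt_singularRatio (C := C) (Real.exp_pos s)).comp s
      (Real.hasDerivAt_exp s)).congr_deriv ?_
    have := (Real.exp_pos s).ne'
    field_simp
  have hzd : ∀ s, HasDerivAt (fun s => logSlope m V (Real.exp s)) _ s := fun s =>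
    (h.hasDerivAt_logSlope hm hm1 hN hρ (Real.exp_pos s)).comp s (Real.hasDerivAt_exp s)
  refine exists_tendsto_mul_exp_of_hasDerivAt
    (f := fun s => 1 - singularRatio m C V (Real.exp s))
    (y := fun s => logSlope m V (Real.exp s) / (1 - singularRatio m C V (Real.exp s)))
    (E := capA n m ρ β / (1 - m)) (D := 2 * (n - 2 - n * m) * β / ((1 - m) * ρ))
    (k := m / (1 - m) + 1) (Q := 2 * (n - 2 - n * m) / (1 - m))
    hf0 (fun s => by linarith [hw0 s]) (fun s => div_pos (hz0 s) (hf0 s))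
    (fun s => (div_lt_iff₀ (hf0 s)).2 (hzw s)) (fun s => ?_) (fun s => ?_)
    (by positivity) (by positivity) (by positivity) hγ2 hγQ
  · refine ((hwd s).const_sub 1).congr_deriv ?_
    have := (hf0 s).ne'
    field_simp
    ring
  · refine ((hzd s).div ((hwd s).const_sub 1) (hf0 s).ne').congr_deriv ?_
    have he := (Real.exp_pos s).ne'
    have hf := (hf0 s).ne'
    rw [div_mul_cancel₀ _ he]
    generalize singularRatio m C V (Real.exp s) = w at hf ⊢
    generalize logSlope m V (Real.exp s) = z
    generalize capA n m ρ β / (1 - m) = E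
    generalize 2 * ((n : ℝ) - 2 - n * m) * β / ((1 - m) * ρ) = D
    generalize m / (1 - m) = θ
    generalize 2 * ((n : ℝ) - 2 - n * m) / (1 - m) = Q
    field_simp
    ring

theorem eq_mul_rpow_singularRatio (h : IsRadialProfile n m (alphaCoeff m ρ β) β V)
    (hm : 0 < m) (hm1 : m < 1) (hN : 0 < (n : ℝ) - 2 - n * m) (hρ : 0 < ρ) {r : ℝ} (hr : 0 < r) :
    V r = (cStar n m ρ / r ^ 2) ^ (1 / (1 - m)) *
      singularRatio m (cStar n m ρ) V r ^ (1 / (1 - m)) := by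
  have hm1' : 0 < 1 - m := by linarith
  have hC : 0 < cStar n m ρ := by rw [cStar]; positivity
  rw [← Real.mul_rpow (by positivity) (h.singularRatio_pos hm hm1 hN hρ hr).le, singularRatio,
    show cStar n m ρ / r ^ 2 * (r ^ 2 * V r ^ (1 - m) / cStar n m ρ) = V r ^ (1 - m) by
      field_simp,
    ← Real.rpow_mul (h.pos r).le, mul_one_div_cancel hm1'.ne', Real.rpow_one]

end IsRadialProfile

/-! ### Expansion at infinity -/

theorem theorem1p3 (n : ℕ) (hn : 3 ≤ n) (m : ℝ) (hm : 0 < m) (hmn : m < ((n : ℝ) - 2) / n) :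
    ∃ b : ℝ, ∀ ρ₁ : ℝ, 0 < ρ₁ →
      max (betaZero n m ρ₁) (betaOne n m ρ₁) ≤ b * ρ₁ ∧
      ∀ β : ℝ, b * ρ₁ < β →
        0 < gammaOne n m ρ₁ β ∧
        ∀ lam : ℝ, 0 < lam →
          ∀ v : EuclideanSpace ℝ (Fin n) → ℝ,
            IsEntireSolution m (alphaCoeff m ρ₁ β) β v → IsRadial v → v 0 = lam →
              ∃ B : ℝ, 0 < B ∧ ∃ e : EuclideanSpace ℝ (Fin n) → ℝ,
                e =o[Bornology.cobounded (EuclideanSpace ℝ (Fin n))]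
                  (fun x => ‖x‖ ^ (-gammaOne n m ρ₁ β)) ∧
                ∀ x, x ≠ 0 →
                  v x = (cStar n m ρ₁ / ‖x‖ ^ 2) ^ (1 / (1 - m)) *
                    (1 - B * ‖x‖ ^ (-gammaOne n m ρ₁ β) + e x) := by
  have hn' : (3 : ℝ) ≤ n := by exact_mod_cast hn
  rw [lt_div_iff₀ (by linarith)] at hmn
  have hm1 : m < 1 := by nlinarith
  have hm1' : 0 < 1 - m := by linarith
  have hN : 0 < (n : ℝ) - 2 - n * m := by linarith
  -- `β₀` and `β₁` are proportional to `ρ₁`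
  have hb0 : ∀ ρ₁ : ℝ, betaZero n m ρ₁ = betaZero n m 1 * ρ₁ := fun ρ₁ => by
    simp only [betaZero]; split_ifs <;> ring
  have hb1 : ∀ ρ₁ : ℝ, betaOne n m ρ₁ = betaOne n m 1 * ρ₁ := fun ρ₁ => by
    simp only [betaOne]; ring
  refine ⟨max (betaZero n m 1) (betaOne n m 1), fun ρ₁ hρ => ?_⟩
  have hmax : max (betaZero n m ρ₁) (betaOne n m ρ₁)
      = max (betaZero n m 1) (betaOne n m 1) * ρ₁ := by
    rw [max_mul_of_nonneg _ _ hρ.le, ← hb0, ← hb1]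
  refine ⟨hmax.le, fun β hβ => ?_⟩
  have hβ1 : betaOne n m ρ₁ < β := (le_max_right _ _).trans_lt (hmax ▸ hβ)
  obtain ⟨hγ, -, -⟩ := gammaOne_spec hm1 hN hρ hβ1
  refine ⟨hγ, fun lam _ v hv hr _ => ?_⟩
  set γ := gammaOne n m ρ₁ β
  have hV := hv.isRadialProfile hr ⟨0, by omega⟩
  set V : ℝ → ℝ := fun t => v (EuclideanSpace.single ⟨0, by omega⟩ t)
  have hvV : ∀ x, v x = V ‖x‖ := fun x => hr _ _ (by simp)
  obtain ⟨B, hB, hlim⟩ :=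
    hV.exists_tendsto_one_sub_singularRatio_mul_exp hn hm hm1 hN hρ hβ1
  refine ⟨1 / (1 - m) * B, by positivity, fun x =>
    singularRatio m (cStar n m ρ₁) V ‖x‖ ^ (1 / (1 - m)) - 1
      + 1 / (1 - m) * B * ‖x‖ ^ (-γ), ?_, fun x hx => ?_⟩
  · have hlo := (isLittleO_one_sub_rpow (q := 1 / (1 - m)) hγ hlim).comp_tendsto
      (Real.tendsto_log_atTop.comp (tendsto_norm_cobounded_atTop
        (E := EuclideanSpace ℝ (Fin n))))
    have hne : ∀ᶠ x : EuclideanSpace ℝ (Fin n) in Bornology.cobounded _, 0 < ‖x‖ :=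
      (tendsto_norm_cobounded_atTop).eventually_gt_atTop 0
    have hpow : ∀ x : EuclideanSpace ℝ (Fin n), 0 < ‖x‖ →
        Real.exp (-γ * Real.log ‖x‖) = ‖x‖ ^ (-γ) := fun x hx => by
      rw [Real.rpow_def_of_pos hx, mul_comm]
    refine hlo.congr' ?_ ?_
    · filter_upwards [hne] with x hx
      simp only [Function.comp, sub_sub_cancel]
      rw [hpow x hx, Real.exp_log hx]
    · filter_upwards [hne] with x hx
      exact hpow x hx
  · rw [hvV x, hV.eq_mul_rpow_singularRatio hm hm1 hN hρ (norm_pos_iff.2 hx)]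
    ring
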